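/- For a partition $\pi$ let $n_1(\pi)\ge n_2(\pi)\ge\cdots$ be the sides of its successive Durfee squares. For $j\ge 2$, the $j$-rank of a partition $\pi$ with at least $j-1$ successive Durfee squares is the number of columns of the Ferrers graph of $\pi$ that lie to the right of the first Durfee square and have length at most $n_{j-1}(\pi)$, minus the number of parts of $\pi$ that lie below the $(j-1)$-st Durfee square. For $j\ge2$, $m\in\mathbb Z$ and $n\ge 0$ let $N_j(m,n)$ be the number of partitions of $n$ with at least $j-1$ successive Durfee squares whose $j$-rank is $m$. Let $N_1(m,n)=M(m,n)$ be the number of partitions of $n$ whose crank is $m$, where the crank of a partition is its largest part (0 for the empty partition) if it contains no ones, and otherwise the number of parts larger than the number of ones minus the number of ones; for $n=1$ we use the customary convention $M(1,1)=M(-1,1)=1$, $M(0,1)=-1$ and $M(m,1)=0$ for $|m|\ge 2$. We have $N_j(m,n)=0$ for $|m|>n$, so that all the following sums over $m$ are finite. Define $${}_jN_t(n)=\sum_{m=-\infty}^{\infty}m^tN_j(m,n),\qquad {}_j\mu_{k}(n)=\sum_{m=-\infty}^{\infty}\binom{m+\lfloor\frac{k-1}{2}\rfloor}{k}N_j(m,n),$$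 where $\binom{x}{k}=x(x-1)\cdots(x-k+1)/k!$ for every integer $x$. Let $g_k(x)=\prod_{i=0}^{k-1}(x^2-i^2)$ for $k\ge1$, and let the numbers $S^*(n,k)$, $1\le k\le n$, be determined by the polynomial identities $x^{2n}=\sum_{k=1}^{n}S^*(n,k)\,g_k(x)$, $n\ge1$. **Theorem.** For all integers $j\ge1$, $k\ge1$ and $n\ge0$, $${}_j\mu_{2k}(n)=\frac1{(2k)!}\sum_{m=-n}^{n}g_k(m)\,N_j(m,n),\qquad {}_jN_{2k}(n)=\sum_{t=1}^{k}(2t)!\,S^*(k,t)\,{}_j\mu_{2t}(n).$$ -/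

import Mathlib

namespace JRank

/-- The parts of a partition, in weakly decreasing order: the rows of its Ferrers graph. -/
def rows {n : ℕ} (p : n.Partition) : List ℕ := p.parts.sort (· ≥ ·)

/-- The side of the Durfee square of the Ferrers graph with row lengths `L`: the largest `d` such
that at least `d` of the rows have length at least `d`. -/
def durfeeSide (L : List ℕ) : ℕ :=
  Nat.findGreatest (fun d => d ≤ (L.filter (fun r => d ≤ r)).length) L.length

/-- The rows (in decreasing order) that lie below the first `i` successive Durfee squares: in each
step the rows that meet the Durfee square of the remaining Ferrers graph are removed. -/
def rowsBelow {n : ℕ} (p : n.Partition) : ℕ → List ℕ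
  | 0 => rows p
  | i + 1 => (rowsBelow p i).drop (durfeeSide (rowsBelow p i))

/-- The side `n_i(π)` of the `i`-th successive Durfee square, for `i ≥ 1`. It is `0` exactly when
the partition has fewer than `i` successive Durfee squares. -/
def successiveDurfee {n : ℕ} (p : n.Partition) (i : ℕ) : ℕ := durfeeSide (rowsBelow p (i - 1))

/-- The length of the `c`-th column (counted from `1`) of the Ferrers graph. -/
def columnLength {n : ℕ} (p : n.Partition) (c : ℕ) : ℕ :=
  (p.parts.filter (fun r => c ≤ r)).card

/-- The `j`-rank for `j ≥ 2` of a partition with at least `j - 1` successive Durfee squares: the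
number of columns to the right of the first Durfee square that have length at most `n_{j-1}(π)`,
minus the number of parts below the `(j-1)`-st Durfee square. The columns of the Ferrers graph are
numbered from `1` to the largest part. -/
def jRank {n : ℕ} (j : ℕ) (p : n.Partition) : ℤ :=
  (((Finset.Ioc (successiveDurfee p 1) p.parts.sup).filter
      (fun c => columnLength p c ≤ successiveDurfee p (j - 1))).card : ℤ)
    - ((rowsBelow p (j - 1)).length : ℤ)

/-- The Andrews-Garvan crank of a partition. -/
def crank {n : ℕ} (p : n.Partition) : ℤ :=
  if p.parts.count 1 = 0 then (p.parts.sup : ℤ)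
  else ((p.parts.filter (fun r => p.parts.count 1 < r)).card : ℤ) - (p.parts.count 1 : ℤ)

/-- `M(m,n)`: the number of partitions of `n` with crank `m`, with the customary values
`M(-1,1) = M(1,1) = 1`, `M(0,1) = -1` for `n = 1`, which are the ones given by the crank generating
function `(q)_∞ / ((zq)_∞ (z⁻¹q)_∞)`. -/
def crankCount (m : ℤ) (n : ℕ) : ℤ :=
  if n = 1 then (if m = 0 then -1 else if m = 1 ∨ m = -1 then 1 else 0)
  else ((Finset.univ.filter (fun p : n.Partition => crank p = m)).card : ℤ)

/-- `N_j(m,n)` for `j ≥ 1`: for `j ≥ 2` the number of partitions of `n` with at least `j - 1`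
successive Durfee squares and `j`-rank `m`; for `j = 1` it is `M(m,n)`. -/
def rankCount (j : ℕ) (m : ℤ) (n : ℕ) : ℤ :=
  if j = 1 then crankCount m n
  else ((Finset.univ.filter
    (fun p : n.Partition => 0 < successiveDurfee p (j - 1) ∧ jRank j p = m)).card : ℤ)

/-- The `j`-rank moment `_jN_t(n) = ∑_{m ∈ ℤ} m^t N_j(m,n)` (a sum with finite support). -/
noncomputable def moment (j t n : ℕ) : ℤ := ∑ᶠ m : ℤ, m ^ t * rankCount j m n

/-- The `k`-th symmetrized `j`-rank moment
`_jμ_k(n) = ∑_{m ∈ ℤ} binom(m + ⌊(k-1)/2⌋, k) N_j(m,n)` (a sum with finite support), with the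
generalized binomial coefficient `binom(x, k) = x(x-1)⋯(x-k+1)/k!` for `x ∈ ℤ`. -/
noncomputable def symMoment (j k n : ℕ) : ℤ :=
  ∑ᶠ m : ℤ, Ring.choose (m + ((k : ℤ) - 1) / 2) k * rankCount j m n

/-- The polynomial `g_k(x) = ∏_{i=0}^{k-1} (x² - i²)`. -/
noncomputable def g (k : ℕ) : Polynomial ℤ :=
  ∏ i ∈ Finset.range k, (Polynomial.X ^ 2 - Polynomial.C ((i : ℤ) ^ 2))

theorem exists_stirling : ∃ S : ℕ → ℕ → ℤ, ∀ n : ℕ, 1 ≤ n →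
    (Polynomial.X : Polynomial ℤ) ^ (2 * n)
      = ∑ k ∈ Finset.Icc 1 n, Polynomial.C (S n k) * g k := by
  have key : ∀ n : ℕ, 1 ≤ n → ∃ S : ℕ → ℤ, (Polynomial.X : Polynomial ℤ) ^ (2 * n)
      = ∑ k ∈ Finset.Icc 1 n, Polynomial.C (S k) * g k := by
    intro n hn
    induction n, hn using Nat.le_induction with
    | base => exact ⟨fun _ => 1, by simp [g]⟩
    | succ n hn ih =>
      obtain ⟨S, hS⟩ := ih
      refine ⟨fun k => (if k ≤ n then (k : ℤ) ^ 2 * S k else 0)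
        + (if 2 ≤ k then S (k - 1) else 0), ?_⟩
      have hg : ∀ k, (Polynomial.X : Polynomial ℤ) ^ 2 * g k
          = g (k + 1) + Polynomial.C ((k : ℤ) ^ 2) * g k := by
        intro k
        rw [g, g, Finset.prod_range_succ]
        ring
      have h1 : ∑ k ∈ Finset.Icc 1 (n + 1),
          Polynomial.C (if k ≤ n then (k : ℤ) ^ 2 * S k else 0) * g k
          = ∑ k ∈ Finset.Icc 1 n, Polynomial.C ((k : ℤ) ^ 2 * S k) * g k := by
        rw [Finset.sum_Icc_succ_top (by omega)]
        simp only [Nat.not_succ_le_self, if_false, Polynomial.C_0, zero_mul, add_zero]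
        refine Finset.sum_congr rfl fun k hk => ?_
        rw [if_pos (Finset.mem_Icc.1 hk).2]
      have h2 : ∑ k ∈ Finset.Icc 1 (n + 1),
          Polynomial.C (if 2 ≤ k then S (k - 1) else 0) * g k
          = ∑ k ∈ Finset.Icc 1 n, Polynomial.C (S k) * g (k + 1) := by
        rw [← Finset.add_sum_Ioc_eq_sum_Icc (by omega : 1 ≤ n + 1)]
        simp only [show ¬ (2 ≤ 1) by omega, if_false, Polynomial.C_0, zero_mul, zero_add]
        symm
        refine Finset.sum_bij (fun k _ => k + 1) ?_ ?_ ?_ ?_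
        · intro k hk
          simp only [Finset.mem_Icc, Finset.mem_Ioc] at *
          omega
        · intro a _ b _ h
          omega
        · intro b hb
          simp only [Finset.mem_Ioc] at hb
          exact ⟨b - 1, by simp only [Finset.mem_Icc]; omega, by omega⟩
        · intro k hk
          simp only [Finset.mem_Icc] at hk
          rw [if_pos (by omega)]
          simp
      simp only [Polynomial.C_add, add_mul, Finset.sum_add_distrib]
      rw [h1, h2, ← Finset.sum_add_distrib, show 2 * (n + 1) = 2 + 2 * n by ring, pow_add, hS,
        Finset.mul_sum]
      refine Finset.sum_congr rfl fun k _ => ?_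
      rw [mul_left_comm, hg, Polynomial.C_mul]
      ring
  choose! S hS using key
  exact ⟨S, hS⟩

/-- The numbers `S*(n,k)`, `1 ≤ k ≤ n`, defined by `x^{2n} = ∑_{k=1}^n S*(n,k) g_k(x)` as an
identity of polynomials in `x`, for `n ≥ 1`. -/
noncomputable def sStar : ℕ → ℕ → ℤ := Classical.choose exists_stirling

theorem sStar_spec (n : ℕ) (hn : 1 ≤ n) :
    (Polynomial.X : Polynomial ℤ) ^ (2 * n)
      = ∑ k ∈ Finset.Icc 1 n, Polynomial.C (sStar n k) * g k :=
  Classical.choose_spec exists_stirling n hn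

theorem eval_g (k : ℕ) (x : ℤ) :
    (g k).eval x = ∏ i ∈ Finset.range k, (x ^ 2 - (i : ℤ) ^ 2) := by
  simp [g, Polynomial.eval_prod]

/-- The defining identity determines the numbers `S*(n,k)` for `1 ≤ k ≤ n`. -/
theorem sStar_unique (n : ℕ) (hn : 1 ≤ n) (a : ℕ → ℤ)
    (ha : (Polynomial.X : Polynomial ℤ) ^ (2 * n)
      = ∑ k ∈ Finset.Icc 1 n, Polynomial.C (a k) * g k) :
    ∀ k, 1 ≤ k → k ≤ n → a k = sStar n k := by
  intro k
  induction k using Nat.strong_induction_on with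
  | _ k ih =>
    intro hk hkn
    have h := congrArg (Polynomial.eval (k : ℤ)) ((sStar_spec n hn).symm.trans ha)
    simp only [Polynomial.eval_finsetSum, Polynomial.eval_mul, Polynomial.eval_C] at h
    have h0 : ∑ i ∈ Finset.Icc 1 n, (a i - sStar n i) * (g i).eval (k : ℤ) = 0 := by
      simp only [sub_mul, Finset.sum_sub_distrib, h, sub_self]
    rw [Finset.sum_eq_single k] at h0
    · rcases mul_eq_zero.1 h0 with h1 | h1
      · omega
      · rw [eval_g, Finset.prod_eq_zero_iff] at h1
        obtain ⟨i, hi, h2⟩ := h1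
        have h3 : i < k := Finset.mem_range.1 hi
        have h4 : (i : ℤ) < k := by exact_mod_cast h3
        have h5 : (0 : ℤ) ≤ i := by positivity
        nlinarith
    · intro i hi hik
      rcases lt_or_gt_of_ne hik with hlt | hgt
      · rw [ih i hlt (Finset.mem_Icc.1 hi).1 (by omega), sub_self, zero_mul]
      · rw [eval_g, Finset.prod_eq_zero (Finset.mem_range.2 hgt) (sub_self _), mul_zero]
    · intro hk'
      exact absurd (Finset.mem_Icc.2 ⟨hk, hkn⟩) hk'

theorem length_rowsBelow_le {n : ℕ} (p : n.Partition) (i : ℕ) :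
    (rowsBelow p i).length ≤ p.parts.card := by
  induction i with
  | zero => simp [rowsBelow, rows]
  | succ i ih =>
    simp only [rowsBelow, List.length_drop]
    omega

theorem card_parts_le {n : ℕ} (p : n.Partition) : p.parts.card ≤ n := by
  have h := Multiset.card_nsmul_le_sum (s := p.parts) (a := 1) (fun x hx => p.parts_pos hx)
  simpa [p.parts_sum] using h

theorem sup_parts_le {n : ℕ} (p : n.Partition) : p.parts.sup ≤ n :=
  Multiset.sup_le.2 fun _ hx => Nat.Partition.le_of_mem_parts hx

theorem count_parts_le {n : ℕ} (p : n.Partition) : p.parts.count 1 ≤ n :=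
  (Multiset.count_le_card 1 p.parts).trans (card_parts_le p)

/-- `N_j(m,n) = 0` for `|m| > n`, so the sums over `m` in the moments have finite support. -/
theorem rankCount_eq_zero (j : ℕ) (m : ℤ) (n : ℕ) (h : (n : ℤ) < |m|) : rankCount j m n = 0 := by
  have hm := lt_abs.1 h
  unfold rankCount crankCount
  split_ifs with h1 h2 h3 h4
  · omega
  · omega
  · rfl
  · rw [Nat.cast_eq_zero, Finset.card_eq_zero, Finset.filter_eq_empty_iff]
    intro p _ hp
    have e1 := sup_parts_le p
    have e2 := card_parts_le p
    have e3 := count_parts_le p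
    have e4 := Multiset.card_le_card
      (Multiset.filter_le (fun r => p.parts.count 1 < r) p.parts)
    unfold crank at hp
    split_ifs at hp <;> omega
  · rw [Nat.cast_eq_zero, Finset.card_eq_zero, Finset.filter_eq_empty_iff]
    rintro p _ ⟨_, hp⟩
    have e1 := sup_parts_le p
    have e2 := card_parts_le p
    have e3 := length_rowsBelow_le p (j - 1)
    have e4 := Finset.card_filter_le (Finset.Ioc (successiveDurfee p 1) p.parts.sup)
      (fun c => columnLength p c ≤ successiveDurfee p (j - 1))
    rw [Nat.card_Ioc] at e4
    unfold jRank at hp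
    omega

end JRank

/-! Everything rests on the symmetry $N_j(-m,n)=N_j(m,n)$ (`rankCount_neg`). Granted it, every odd
function of $m$ sums to zero against $N_j(m,n)$. Now $(2k)!\binom{m+k-1}{2k}$ is a product of $2k$
consecutive integers and equals $g_k(m)$ minus an odd polynomial in $m$ (`factorial_mul_choose`),
which gives the first formula. The second is the first inserted into the expansion of $m^{2k}$ in
the $g_t(m)$.

For $j\ge2$ the symmetry is an involution (`swap_spec`). Let $e$ be the side of the $(j-1)$-st
Durfee square. The columns counted by the rank form a partition with parts at most $e$, and so do
the rows below that square; exchanging the two negates the rank.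

For $j=1$, mark $w$ of the ones of a partition and consider the number of rows longer than $w$,
minus $w$. An involution exchanges these two numbers (`markedSwap_spec`). For $w=0$, conjugation
turns the number of rows into the largest part (`ncard_markedCrank`). A marked partition of $n+1$
either has an unmarked one, which can be deleted, or has all its ones marked, and then its statistic
is the crank. So for $n\ge1$ the crank counts of $n+1$ are differences of symmetric counts
(`ncard_markedCrank_succ`). -/

namespace JRank

/-! ### Conjugation of lists of row lengths -/

/-- The first `m` column lengths of the Ferrers graph with row lengths `X`. -/
def conj (X : List ℕ) (m : ℕ) : List ℕ :=
  (List.range m).map fun i => X.countP (fun x => i < x)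

/-- The conjugate of a partition with parts at most `e`, as a list of length `e`, shifted by `c`. -/
def up (c e : ℕ) (B : List ℕ) : List ℕ := (conj B e).map (c + ·)

/-- The conjugate of the partition obtained from `T` by subtracting `c` from each entry. -/
def down (c : ℕ) (T : List ℕ) : List ℕ := conj (T.map (· - c)) (T.headD 0 - c)

/-- In a decreasing list the entries above `j` form an initial segment. This duality between
counting and indexing underlies every conjugation argument below. -/
theorem lt_countP_iff {X : List ℕ} (hX : X.Pairwise (· ≥ ·)) (i j : ℕ) :
    i < X.countP (fun x => j < x) ↔ j < X.getD i 0 := by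
  induction X generalizing i with
  | nil => simp
  | cons a X ih =>
    rw [List.pairwise_cons] at hX
    rw [List.countP_cons]
    by_cases h : j < a
    · cases i with
      | zero => simp [h]
      | succ i => simp [h, ih hX.2]
    · have h0 : X.countP (fun x => j < x) = 0 := by
        rw [List.countP_eq_zero]
        intro x hx
        have := hX.1 x hx
        simp
        omega
      cases i with
      | zero => simp [h, h0]
      | succ i =>
        simp only [h0, h, decide_false]
        have := ih hX.2 i
        simp_all

theorem length_conj (X : List ℕ) (m : ℕ) : (conj X m).length = m := by simp [conj]

theorem pairwise_conj (X : List ℕ) (m : ℕ) : (conj X m).Pairwise (· ≥ ·) := by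
  rw [conj, List.pairwise_map]
  refine List.pairwise_lt_range.imp fun {a b} h => ?_
  refine List.countP_mono_left fun x _ hx => ?_
  simp at hx ⊢
  omega

theorem le_length_of_mem_conj {X : List ℕ} {m y : ℕ} (h : y ∈ conj X m) : y ≤ X.length := by
  simp only [conj, List.mem_map] at h
  obtain ⟨i, _, rfl⟩ := h
  exact List.countP_le_length

theorem pos_of_mem_conj {X : List ℕ} {m y : ℕ} (hm : m ≤ X.headD 0) (h : y ∈ conj X m) :
    0 < y := by
  simp only [conj, List.mem_map, List.mem_range] at h
  obtain ⟨i, hi, rfl⟩ := h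
  rw [List.countP_pos_iff]
  cases X with
  | nil => simp at hm; omega
  | cons a X => exact ⟨a, by simp, by simp at hm ⊢; omega⟩

theorem countP_lt_range {m a : ℕ} (h : a ≤ m) : (List.range m).countP (fun j => j < a) = a := by
  induction m generalizing a with
  | zero => simp; omega
  | succ m ih =>
    rw [List.range_succ, List.countP_append]
    rcases Nat.lt_or_ge m a with h1 | h1
    · have : (List.range m).countP (fun j => decide (j < a)) = m := by
        have := List.countP_eq_length (l := List.range m) (p := fun j => decide (j < a))
        rw [List.length_range] at this
        rw [this]
        intro x hx
        simp at hx ⊢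
        omega
      simp [this, h1]
      omega
    · rw [ih h1]
      simp
      omega

theorem conj_conj {X : List ℕ} (hX : X.Pairwise (· ≥ ·)) {m : ℕ} (hm : ∀ x ∈ X, x ≤ m) :
    conj (conj X m) X.length = X := by
  refine List.ext_getElem (length_conj _ _) fun i h1 h2 => ?_
  simp only [conj, List.getElem_map, List.getElem_range, List.countP_map]
  have : (List.range m).countP ((fun x => decide (i < x)) ∘
      fun i => X.countP (fun x => decide (i < x))) = (List.range m).countP (fun j => j < X[i]) := by
    refine List.countP_congr fun j _ => ?_
    simp [lt_countP_iff hX, h2]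
  rw [this, countP_lt_range (hm _ (List.getElem_mem h2))]

/-- Double counting of cells: a row `a` adds one to each of the first `a` columns. -/
theorem sum_conj {X : List ℕ} {m : ℕ} (hm : ∀ x ∈ X, x ≤ m) : (conj X m).sum = X.sum := by
  induction X with
  | nil => simp [conj]
  | cons a X ih =>
    rw [List.sum_cons, ← ih fun x hx => hm x (List.mem_cons_of_mem _ hx)]
    simp only [conj, List.countP_cons, List.sum_map_add]
    rw [add_comm]
    congr 1
    refine Eq.trans ?_ (countP_lt_range (hm a (by simp)))
    generalize List.range m = l
    induction l with
    | nil => simp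
    | cons b l ih => simp [List.countP_cons, ← ih, add_comm]

theorem length_up (c e : ℕ) (B : List ℕ) : (up c e B).length = e := by simp [up, length_conj]

theorem pairwise_up (c e : ℕ) (B : List ℕ) : (up c e B).Pairwise (· ≥ ·) := by
  rw [up, List.pairwise_map]
  exact (pairwise_conj B e).imp fun h => by simpa using h

theorem le_of_mem_up {c e : ℕ} {B : List ℕ} {y : ℕ} (h : y ∈ up c e B) : c ≤ y := by
  simp only [up, List.mem_map] at h
  obtain ⟨i, _, rfl⟩ := h
  omega

theorem sum_map_const_add (c : ℕ) (X : List ℕ) : (X.map (c + ·)).sum = X.length * c + X.sum := by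
  induction X with
  | nil => simp
  | cons a X ih =>
    simp only [List.map_cons, List.sum_cons, ih, List.length_cons]
    ring

theorem sum_up {c e : ℕ} {B : List ℕ} (hB : ∀ b ∈ B, b ≤ e) :
    (up c e B).sum = e * c + B.sum := by
  rw [up, sum_map_const_add, length_conj, sum_conj hB]

theorem headD_up {c e : ℕ} {B : List ℕ} (he : 0 < e) (hB : ∀ b ∈ B, 0 < b) :
    (up c e B).headD 0 = c + B.length := by
  obtain ⟨e, rfl⟩ := Nat.exists_eq_succ_of_ne_zero he.ne'
  have : B.countP (fun x => 0 < x) = B.length := by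
    rw [List.countP_eq_length]
    simpa using hB
  simp [up, conj, List.range_succ_eq_map, this]

theorem le_headD {X : List ℕ} (hX : X.Pairwise (· ≥ ·)) : ∀ x ∈ X, x ≤ X.headD 0 := by
  cases X with
  | nil => simp
  | cons a X => simpa using (List.pairwise_cons.1 hX).1

theorem headD_map_sub (c : ℕ) (T : List ℕ) : (T.map (· - c)).headD 0 = T.headD 0 - c := by
  cases T <;> simp

theorem pairwise_map_sub (c : ℕ) {T : List ℕ} (hT : T.Pairwise (· ≥ ·)) :
    (T.map (· - c)).Pairwise (· ≥ ·) := by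
  rw [List.pairwise_map]
  exact hT.imp fun h => Nat.sub_le_sub_right h c

theorem length_down (c : ℕ) (T : List ℕ) : (down c T).length = T.headD 0 - c := length_conj _ _

theorem pairwise_down (c : ℕ) (T : List ℕ) : (down c T).Pairwise (· ≥ ·) := pairwise_conj _ _

theorem pos_of_mem_down {c : ℕ} {T : List ℕ} {y : ℕ} (h : y ∈ down c T) : 0 < y :=
  pos_of_mem_conj (headD_map_sub c T).ge h

theorem le_of_mem_down {c : ℕ} {T : List ℕ} {y : ℕ} (h : y ∈ down c T) : y ≤ T.length := by
  simpa using le_length_of_mem_conj h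

theorem map_sub_map_add {c : ℕ} {T : List ℕ} (hc : ∀ x ∈ T, c ≤ x) :
    (T.map (· - c)).map (c + ·) = T := by
  rw [List.map_map]
  refine (List.map_congr_left fun x hx => ?_).trans (List.map_id T)
  have := hc x hx
  simp
  omega

theorem up_down {c : ℕ} {T : List ℕ} (hT : T.Pairwise (· ≥ ·)) (hc : ∀ x ∈ T, c ≤ x) :
    up c T.length (down c T) = T := by
  have h := conj_conj (pairwise_map_sub c hT)
    (m := T.headD 0 - c) (by rw [← headD_map_sub]; exact le_headD (pairwise_map_sub c hT))
  rw [List.length_map] at h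
  rw [up, down, h, map_sub_map_add hc]

theorem sum_down {c : ℕ} {T : List ℕ} (hT : T.Pairwise (· ≥ ·)) (hc : ∀ x ∈ T, c ≤ x) :
    T.length * c + (down c T).sum = T.sum := by
  rw [← sum_up fun b hb => le_of_mem_down hb, up_down hT hc]

theorem down_up {c e : ℕ} {B : List ℕ} (hB : B.Pairwise (· ≥ ·)) (h0 : ∀ b ∈ B, 0 < b)
    (he : ∀ b ∈ B, b ≤ e) : down c (up c e B) = B := by
  have h1 : (up c e B).headD 0 - c = B.length := by
    -- For `e = 0` the list `up c e B` is empty and its head says nothing about `B`; but then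
    -- positive entries bounded by `e` cannot exist.
    rcases Nat.eq_zero_or_pos e with rfl | h
    · have : B = [] := List.eq_nil_iff_forall_not_mem.2 fun b hb => by
        have := h0 b hb
        have := he b hb
        omega
      subst this
      simp [up, conj]
    · rw [headD_up h h0]
      omega
  rw [down, h1]
  convert conj_conj hB he
  rw [up, List.map_map]
  refine (List.map_congr_left fun x hx => ?_).trans (List.map_id _)
  simp

/-! ### Partitions as lists of row lengths -/

/-- The lists of row lengths of the Ferrers graphs with `n` cells. -/
structure IsRows (n : ℕ) (L : List ℕ) : Prop where
  sorted : L.Pairwise (· ≥ ·)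
  pos : ∀ x ∈ L, 0 < x
  sum : L.sum = n

theorem isRows_rows {n : ℕ} (p : n.Partition) : IsRows n (rows p) where
  sorted := Multiset.pairwise_sort _ _
  pos x hx := p.parts_pos ((Multiset.mem_sort _).1 hx)
  sum := by
    rw [← Multiset.sum_coe, rows, Multiset.sort_eq, p.parts_sum]

theorem coe_rows {n : ℕ} (p : n.Partition) : (rows p : Multiset ℕ) = p.parts :=
  Multiset.sort_eq _ _

theorem IsRows.exists_partition {n : ℕ} {L : List ℕ} (h : IsRows n L) :
    ∃ p : n.Partition, rows p = L := by
  refine ⟨⟨L, fun hi => h.pos _ (Multiset.mem_coe.1 hi), by rw [Multiset.sum_coe, h.sum]⟩, ?_⟩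
  refine List.Perm.eq_of_pairwise' (Multiset.pairwise_sort _ _) h.sorted ?_
  rw [← Multiset.coe_eq_coe, coe_rows]

theorem rows_injective {n : ℕ} : Function.Injective (rows (n := n)) := fun p q h =>
  Nat.Partition.ext (by rw [← coe_rows, h, coe_rows])

theorem card_filter_partition {n : ℕ} {P : n.Partition → Prop} [DecidablePred P]
    {Q : List ℕ → Prop} (h : ∀ p, P p ↔ Q (rows p)) :
    (Finset.univ.filter P).card = {L | IsRows n L ∧ Q L}.ncard := by
  rw [← Set.ncard_coe_finset, ← Set.ncard_image_of_injective _ rows_injective]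
  congr 1
  ext L
  constructor
  · rintro ⟨p, hp, rfl⟩
    exact ⟨isRows_rows p, (h p).1 (by simpa using hp)⟩
  · rintro ⟨hL, hQ⟩
    obtain ⟨p, rfl⟩ := hL.exists_partition
    exact ⟨p, by simpa using (h p).2 hQ, rfl⟩

theorem finite_isRows (n : ℕ) : {L | IsRows n L}.Finite := by
  refine (Set.finite_range (rows (n := n))).subset fun L hL => ?_
  exact IsRows.exists_partition hL

theorem sup_parts {n : ℕ} (p : n.Partition) : p.parts.sup = (rows p).headD 0 := by
  refine le_antisymm (Multiset.sup_le.2 fun x hx => ?_) ?_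
  · refine le_headD (isRows_rows p).sorted x ?_
    rwa [rows, Multiset.mem_sort]
  · rw [← coe_rows]
    cases rows p <;> simp

/-! ### Successive Durfee squares -/

/-- The rows below the first `i` successive Durfee squares of the graph with row lengths `L`. -/
def below (L : List ℕ) : ℕ → List ℕ
  | 0 => L
  | i + 1 => (below L i).drop (durfeeSide (below L i))

theorem rowsBelow_eq {n : ℕ} (p : n.Partition) (i : ℕ) : rowsBelow p i = below (rows p) i := by
  induction i with
  | zero => rfl
  | succ i ih => rw [rowsBelow, below, ih]

/-- Peels off the first square instead of the last, as the induction in `exists_middle_rows`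
requires. -/
theorem below_succ' (L : List ℕ) (i : ℕ) :
    below L (i + 1) = below (L.drop (durfeeSide L)) i := by
  induction i with
  | zero => rfl
  | succ i ih => rw [below, ih, below]

theorem below_suffix (L : List ℕ) (i : ℕ) : below L i <:+ L := by
  induction i with
  | zero => exact List.suffix_rfl
  | succ i ih => exact (List.drop_suffix _ _).trans ih

theorem durfeeSide_append {X Y : List ℕ} (hX : ∀ x ∈ X, X.length ≤ x)
    (hY : ∀ y ∈ Y, y ≤ X.length) : durfeeSide (X ++ Y) = X.length := by
  rw [durfeeSide, Nat.findGreatest_eq_iff]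
  refine ⟨by simp, fun _ => ?_, fun k hk _ => ?_⟩
  · rw [List.filter_append, List.length_append, List.filter_eq_self.2 (by simpa using hX)]
    omega
  · have h1 : Y.filter (fun r => decide (k ≤ r)) = [] := by
      rw [List.filter_eq_nil_iff]
      intro y hy
      have := hY y hy
      simp
      omega
    have h2 := List.length_filter_le (fun r => decide (k ≤ r)) X
    rw [List.filter_append, h1, List.append_nil]
    omega

theorem durfeeSide_le_length (L : List ℕ) : durfeeSide L ≤ L.length := Nat.findGreatest_le _

theorem durfeeSide_le_countP (L : List ℕ) :
    durfeeSide L ≤ L.countP (fun r => durfeeSide L ≤ r) := by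
  have h := Nat.findGreatest_spec (P := fun d => d ≤ (L.filter (fun r => d ≤ r)).length)
    (Nat.zero_le L.length) (by simp)
  rwa [← List.countP_eq_length_filter] at h

theorem le_durfeeSide {L : List ℕ} {d : ℕ} (h : d ≤ L.countP (fun r => d ≤ r)) :
    d ≤ durfeeSide L :=
  Nat.le_findGreatest (h.trans List.countP_le_length)
    (by rwa [← List.countP_eq_length_filter])

theorem durfeeSide_mono {L M : List ℕ} (h : L <:+ M) : durfeeSide L ≤ durfeeSide M :=
  le_durfeeSide ((durfeeSide_le_countP L).trans h.countP_le)

theorem durfeeSide_le_of_mem_take {L : List ℕ} (hL : L.Pairwise (· ≥ ·)) :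
    ∀ x ∈ L.take (durfeeSide L), durfeeSide L ≤ x := by
  intro x hx
  obtain ⟨i, hi, rfl⟩ := List.mem_take_iff_getElem.1 hx
  have hi' : i < durfeeSide L := by omega
  have hl : i < L.length := by omega
  obtain ⟨d, hd⟩ := Nat.exists_eq_succ_of_ne_zero (show durfeeSide L ≠ 0 by omega)
  have h1 := durfeeSide_le_countP L
  rw [hd] at h1 hi'
  have h2 := (lt_countP_iff hL i d).1 (by
    refine lt_of_lt_of_le hi' (h1.trans (List.countP_mono_left fun x _ h => ?_))
    simpa using h)
  simp only [hl, List.getD_eq_getElem] at h2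
  omega

theorem le_durfeeSide_of_mem_drop {L : List ℕ} (hL : L.Pairwise (· ≥ ·)) :
    ∀ x ∈ L.drop (durfeeSide L), x ≤ durfeeSide L := by
  intro x hx
  obtain ⟨i, hi, rfl⟩ := List.mem_drop_iff_getElem.1 hx
  by_contra hcon
  have h1 := (lt_countP_iff hL (i + durfeeSide L) (durfeeSide L)).2 (by
    rw [List.getD_eq_getElem _ _ (by omega)]
    simp only [add_comm i]
    exact not_le.1 hcon)
  have h2 : L.countP (fun r => durfeeSide L < r) = L.countP (fun r => durfeeSide L + 1 ≤ r) := rfl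
  have h3 : durfeeSide L + 1 ≤ durfeeSide L := le_durfeeSide (by omega)
  omega

/-- The rows between the first Durfee square and those below the `(i+1)`-st one: the first and the
last block of rows can be exchanged without any effect on the Durfee squares. -/
theorem exists_middle_rows {L : List ℕ} (hL : L.Pairwise (· ≥ ·)) (i : ℕ) :
    ∃ Z, L.drop (durfeeSide L) = Z ++ below L (i + 1) ∧
      (∀ z ∈ Z, durfeeSide (below L i) ≤ z) ∧
      ∀ X B : List ℕ, X.length = durfeeSide L → (∀ x ∈ X, durfeeSide L ≤ x) →
        (∀ b ∈ B, b ≤ durfeeSide (below L i)) →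
        durfeeSide (X ++ (Z ++ B)) = durfeeSide L ∧ below (X ++ (Z ++ B)) (i + 1) = B ∧
          durfeeSide (below (X ++ (Z ++ B)) i) = durfeeSide (below L i) := by
  induction i generalizing L with
  | zero =>
    refine ⟨[], rfl, by simp, fun X B h1 h2 h3 => ?_⟩
    have h4 : durfeeSide (X ++ B) = X.length := durfeeSide_append (by rwa [h1]) (by rwa [h1])
    simp only [below, List.nil_append, h4, List.drop_left] at h3 ⊢
    exact ⟨h1, trivial, h1⟩
  | succ i ih =>
    set Y := L.drop (durfeeSide L) with hY
    have hYs : Y.Pairwise (· ≥ ·) := hL.drop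
    obtain ⟨Z, hZ, hZe, h⟩ := ih hYs
    have hb : ∀ k, below L (k + 1) = below Y k := fun k => below_succ' L k
    have hYd := le_durfeeSide_of_mem_drop hL
    have hYL : durfeeSide Y ≤ durfeeSide L := durfeeSide_mono (List.drop_suffix _ _)
    have hiY : durfeeSide (below Y i) ≤ durfeeSide Y := durfeeSide_mono (below_suffix _ _)
    have hsplit : Y = Y.take (durfeeSide Y) ++ Z ++ below Y (i + 1) := by
      rw [List.append_assoc, ← hZ, List.take_append_drop]
    refine ⟨Y.take (durfeeSide Y) ++ Z, by rw [hb]; exact hsplit, ?_, fun X B h1 h2 h3 => ?_⟩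
    · intro z hz
      rw [hb]
      rcases List.mem_append.1 hz with hz | hz
      · exact hiY.trans (durfeeSide_le_of_mem_take hYs z hz)
      · exact hZe z hz
    · rw [hb] at h3 ⊢
      -- Below the first square only the last block changes, so the induction hypothesis is used
      -- with the first block of `Y` kept as it is.
      obtain ⟨h4, h5, h6⟩ := h (Y.take (durfeeSide Y)) B
        (by rw [List.length_take, min_eq_left (durfeeSide_le_length Y)])
        (durfeeSide_le_of_mem_take hYs) h3
      have h7 : durfeeSide (X ++ (Y.take (durfeeSide Y) ++ Z ++ B)) = X.length := by
        refine durfeeSide_append (by rwa [h1]) fun y hy => ?_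
        rw [h1]
        rcases List.mem_append.1 hy with hy | hy
        · refine hYd y ?_
          rw [← hY, hsplit]
          exact List.mem_append_left _ hy
        · exact (h3 y hy).trans (hiY.trans hYL)
      have h8 : ∀ k, below (X ++ (Y.take (durfeeSide Y) ++ Z ++ B)) (k + 1)
          = below (Y.take (durfeeSide Y) ++ (Z ++ B)) k := fun k => by
        rw [below_succ', h7, List.drop_left, List.append_assoc]
      exact ⟨h7.trans h1, by rw [h8, h5], by rw [h8, h6]⟩

/-! ### Symmetry of the `j`-rank for `j ≥ 2` -/

/-- The number of columns to the left of those that are counted by the `(i+2)`-rank. -/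
def rankBase (i : ℕ) (L : List ℕ) : ℕ :=
  ((L.take (durfeeSide L)).drop (durfeeSide (below L i))).headD (durfeeSide L)

/-- The `(i+2)`-rank in terms of the row lengths. -/
def listRank (i : ℕ) (L : List ℕ) : ℤ :=
  ((L.headD 0 - rankBase i L : ℕ) : ℤ) - ((below L (i + 1)).length : ℤ)

/-- Exchange the columns to the right of the first Durfee square that have length at most the side
of the `(i+1)`-st Durfee square with the rows below the `(i+1)`-st Durfee square. -/
def swap (i : ℕ) (L : List ℕ) : List ℕ :=
  up (rankBase i L) (durfeeSide (below L i)) (below L (i + 1)) ++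
    ((L.take (durfeeSide L)).drop (durfeeSide (below L i)) ++
      ((L.drop (durfeeSide L)).take
          ((L.drop (durfeeSide L)).length - (below L (i + 1)).length) ++
        down (rankBase i L) ((L.take (durfeeSide L)).take (durfeeSide (below L i)))))

/-- The possible first and last blocks of rows when the middle blocks are fixed. -/
structure IsFrame (c e : ℕ) (T B : List ℕ) : Prop where
  length : T.length = e
  sorted_left : T.Pairwise (· ≥ ·)
  le_left : ∀ t ∈ T, c ≤ t
  sorted_right : B.Pairwise (· ≥ ·)
  right_le : ∀ b ∈ B, b ≤ e

/-- What `T` has beyond column `c` is a partition into at most `e` parts, so its conjugate has parts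
at most `e`, and conversely for `B`. -/
theorem IsFrame.exchange {c e : ℕ} {T B : List ℕ} (h : IsFrame c e T B) :
    IsFrame c e (up c e B) (down c T) where
  length := length_up _ _ _
  sorted_left := pairwise_up _ _ _
  le_left _ := le_of_mem_up
  sorted_right := pairwise_down _ _
  right_le _ hb := h.length ▸ le_of_mem_down hb

/-- The Durfee data see only `c`, `e`, `R` and `Z`. Quantifying over all frames `T'`, `B'` lets the
same computation serve a graph and its image under `swap`. -/
theorem exists_frame {L : List ℕ} (hL : L.Pairwise (· ≥ ·)) (i : ℕ) :
    ∃ c e T R Z B, L = T ++ (R ++ (Z ++ B)) ∧ IsFrame c e T B ∧ e ≤ c ∧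
      e = durfeeSide (below L i) ∧
      ∀ T' B', IsFrame c e T' B' → (T' ++ (R ++ (Z ++ B'))).Pairwise (· ≥ ·) ∧
        durfeeSide (below (T' ++ (R ++ (Z ++ B'))) i) = e ∧
        rankBase i (T' ++ (R ++ (Z ++ B'))) = c ∧
        below (T' ++ (R ++ (Z ++ B'))) (i + 1) = B' ∧
        swap i (T' ++ (R ++ (Z ++ B'))) = up c e B' ++ (R ++ (Z ++ down c T')) := by
  obtain ⟨Z, hZ, hZe, h⟩ := exists_middle_rows hL i
  set d := durfeeSide L with hd
  set e := durfeeSide (below L i) with he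
  have hed : e ≤ d := durfeeSide_mono (below_suffix _ _)
  set X := L.take d with hX
  have hXl : X.length = d := by rw [hX, List.length_take, min_eq_left (durfeeSide_le_length L)]
  have hXd : ∀ x ∈ X, d ≤ x := durfeeSide_le_of_mem_take hL
  have hYd : ∀ y ∈ L.drop d, y ≤ d := le_durfeeSide_of_mem_drop hL
  have hXs : X.Pairwise (· ≥ ·) := hL.take
  have hYs : (L.drop d).Pairwise (· ≥ ·) := hL.drop
  have hXeq : X.take e ++ X.drop e = X := List.take_append_drop _ _
  have hs : (X.take e ++ X.drop e).Pairwise (· ≥ ·) := by rwa [hXeq]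
  rw [List.pairwise_append] at hs
  obtain ⟨hs1, hs2, hs3⟩ := hs
  have hRd : ∀ x ∈ X.drop e, d ≤ x := fun x hx => hXd x (List.mem_of_mem_drop hx)
  have hTd : ∀ x ∈ X.take e, d ≤ x := fun x hx => hXd x (List.mem_of_mem_take hx)
  set R := X.drop e with hR
  -- `R` is empty exactly when `e = d`; the counted columns then start right after the first square,
  -- hence the default `d`.
  set c := R.headD d with hc
  have hdc : d ≤ c := by
    rw [hc]
    cases hR' : R with
    | nil => simp
    | cons a R' => exact hRd a (by rw [hR']; simp)
  have hTc : ∀ x ∈ X.take e, c ≤ x := by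
    intro x hx
    rw [hc]
    cases hR' : R with
    | nil => exact hTd x hx
    | cons a R' => exact hs3 x hx a (by rw [hR']; simp)
  have hRc : ∀ x ∈ R, x ≤ c := by
    rw [hc]
    cases hR' : R with
    | nil => simp
    | cons a R' =>
      rw [hR'] at hs2
      simpa using (List.pairwise_cons.1 hs2).1
  have hTl : (X.take e).length = e := by rw [List.length_take]; omega
  have hRl : R.length = d - e := by rw [hR, List.length_drop]; omega
  rw [hZ] at hYs hYd
  rw [List.pairwise_append] at hYs
  refine ⟨c, e, X.take e, R, Z, below L (i + 1), ?_, ⟨hTl, hs1, hTc, hYs.2.1, ?_⟩, hed.trans hdc,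
    rfl, ?_⟩
  · rw [← hZ, ← List.append_assoc, hXeq, hX, List.take_append_drop]
  · exact le_durfeeSide_of_mem_drop (hL.sublist (below_suffix L i).sublist)
  · intro T' B' hF
    have hTR : (T' ++ R).length = d := by rw [List.length_append, hF.length, hRl]; omega
    obtain ⟨h1, h2, h3⟩ := h (T' ++ R) B' hTR (by
      intro x hx
      rcases List.mem_append.1 hx with hx | hx
      · exact hdc.trans (hF.le_left x hx)
      · exact hRd x hx) hF.right_le
    rw [List.append_assoc] at h1 h2 h3
    have htake : (T' ++ (R ++ (Z ++ B'))).take d = T' ++ R := by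
      rw [← List.append_assoc, ← hTR, List.take_left]
    have hdrop : (T' ++ (R ++ (Z ++ B'))).drop d = Z ++ B' := by
      rw [← List.append_assoc, ← hTR, List.drop_left]
    have htake' : (T' ++ R).take e = T' := by rw [← hF.length, List.take_left]
    have hdrop' : (T' ++ R).drop e = R := by rw [← hF.length, List.drop_left]
    have hbase : rankBase i (T' ++ (R ++ (Z ++ B'))) = c := by
      rw [rankBase, h1, h3, htake, hdrop']
    refine ⟨?_, h3, hbase, h2, ?_⟩
    · rw [List.pairwise_append, List.pairwise_append, List.pairwise_append]
      refine ⟨hF.sorted_left, ⟨hs2, ⟨hYs.1, hF.sorted_right, ?_⟩, ?_⟩, ?_⟩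
      · exact fun a ha b hb => (hF.right_le b hb).trans (hZe a ha)
      · intro a ha b hb
        refine le_trans ?_ (hRd a ha)
        rcases List.mem_append.1 hb with hb | hb
        · exact hYd b (List.mem_append_left _ hb)
        · exact (hF.right_le b hb).trans hed
      · intro a ha b hb
        refine le_trans ?_ (hF.le_left a ha)
        rcases List.mem_append.1 hb with hb | hb
        · exact hRc b hb
        refine le_trans ?_ hdc
        rcases List.mem_append.1 hb with hb | hb
        · exact hYd b (List.mem_append_left _ hb)
        · exact (hF.right_le b hb).trans hed
    · rw [swap, hbase, h1, h2, h3, htake, hdrop, htake', hdrop', List.length_append,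
        Nat.add_sub_cancel, List.take_left]

/-- Since `e > 0`, the first row is read off `T`: its length is `c` plus the number of counted
columns. The exchange thus swaps that number with the number of rows of `B`, and conjugation
preserves the number of cells. -/
theorem swap_spec {n i : ℕ} {L : List ℕ} (hL : IsRows n L) (he : 0 < durfeeSide (below L i)) :
    IsRows n (swap i L) ∧ 0 < durfeeSide (below (swap i L) i) ∧
      listRank i (swap i L) = - listRank i L ∧ swap i (swap i L) = L := by
  obtain ⟨c, e, T, R, Z, B, hLeq, hF, hec, hee, h⟩ := exists_frame hL.sorted i
  rw [← hee] at he
  obtain ⟨-, -, h3, h4, h5⟩ := h T B hF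
  obtain ⟨k1, k2, k3, k4, k5⟩ := h _ _ hF.exchange
  rw [← hLeq] at h3 h4 h5
  rw [← h5] at k1 k2 k3 k4 k5
  have hpos : ∀ b ∈ B, 0 < b := fun b hb => hL.pos b (by rw [hLeq]; simp [hb])
  have hud : up c e (down c T) = T := by
    rw [← hF.length]
    exact up_down hF.sorted_left hF.le_left
  have hdu : down c (up c e B) = B := down_up hF.sorted_right hpos hF.right_le
  have hhead : ∀ S M : List ℕ, S.length = e → (S ++ M).headD 0 = S.headD 0 := by
    intro S M hS
    cases S with
    | nil => simp at hS; omega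
    | cons a S => rfl
  have hcT : c ≤ T.headD 0 := by
    have := hF.length
    have := hF.le_left
    cases T with
    | nil => simp at *; omega
    | cons a T => simp_all
  refine ⟨⟨k1, ?_, ?_⟩, k2 ▸ he, ?_, ?_⟩
  · intro x hx
    have hL' := hL.pos x
    rw [hLeq] at hL'
    rw [h5] at hx
    simp only [List.mem_append] at hx hL'
    rcases hx with hx | hx | hx | hx
    · exact lt_of_lt_of_le (he.trans_le hec) (le_of_mem_up hx)
    · exact hL' (by tauto)
    · exact hL' (by tauto)
    · exact pos_of_mem_down hx
  · have h6 := hL.sum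
    have h7 := sum_down hF.sorted_left hF.le_left
    rw [hF.length] at h7
    rw [hLeq] at h6
    rw [h5]
    simp only [List.sum_append] at h6 ⊢
    rw [sum_up hF.right_le]
    omega
  · rw [listRank, listRank, h3, h4, k3, k4, length_down, h5, hhead _ _ (length_up _ _ _),
      headD_up he hpos]
    rw [hLeq, hhead _ _ hF.length]
    omega
  · rw [k5, hud, hdu, ← hLeq]

theorem jRank_eq {n : ℕ} (p : n.Partition) (i : ℕ) :
    jRank (i + 2) p = listRank i (rows p) := by
  have h1 : successiveDurfee p 1 = durfeeSide (rows p) := rfl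
  have h2 : successiveDurfee p (i + 2 - 1) = durfeeSide (below (rows p) i) := by
    rw [successiveDurfee, rowsBelow_eq]
    rfl
  have h3 : ∀ c, columnLength p c = (rows p).countP (fun x => c ≤ x) := by
    intro c
    rw [columnLength, ← coe_rows, Multiset.filter_coe, Multiset.coe_card,
      List.countP_eq_length_filter]
  have hs := (isRows_rows p).sorted
  rw [jRank, listRank, h1, h2, rowsBelow_eq, sup_parts]
  simp only [h3]
  generalize rows p = L at *
  congr 2
  rw [← Nat.card_Ioc]
  congr 1
  ext x
  simp only [Finset.mem_filter, Finset.mem_Ioc]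
  -- A column `x > 0` has length at most `e` exactly when the row of index `e` (from 0) is shorter
  -- than `x`. That row is at least `d` if `e < d`, and at most `d` or absent if `e = d`.
  have key : rankBase i L = max (durfeeSide L) (L.getD (durfeeSide (below L i)) 0) := by
    have hed : durfeeSide (below L i) ≤ durfeeSide L := durfeeSide_mono (below_suffix _ _)
    have hdl := durfeeSide_le_length L
    have htake := durfeeSide_le_of_mem_take hs
    have hdrop := le_durfeeSide_of_mem_drop hs
    rw [rankBase, List.headD_eq_head?_getD, List.head?_drop]
    generalize durfeeSide (below L i) = e at *
    generalize durfeeSide L = d at *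
    rcases lt_or_eq_of_le hed with h | rfl
    · rw [List.getElem?_take_of_lt h, List.getElem?_eq_getElem (by omega), Option.getD_some,
        List.getD_eq_getElem _ _ (by omega)]
      exact (max_eq_right (htake _ (List.mem_take_iff_getElem.2 ⟨e, by omega, rfl⟩))).symm
    · rw [List.getElem?_eq_none (by simp), Option.getD_none, max_eq_left]
      rcases Nat.lt_or_ge e L.length with h | h
      · rw [List.getD_eq_getElem _ _ h]
        exact hdrop _ (List.mem_drop_iff_getElem.2 ⟨0, by simpa using h, by simp⟩)
      · rw [List.getD_eq_default _ _ h]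
        exact Nat.zero_le _
  rw [key, max_lt_iff]
  have := lt_countP_iff hs (durfeeSide (below L i)) (x - 1)
  rcases Nat.eq_zero_or_pos x with rfl | hx
  · simp
  obtain ⟨y, rfl⟩ := Nat.exists_eq_succ_of_ne_zero hx.ne'
  have h4 : L.countP (fun r => y < r) = L.countP (fun r => y.succ ≤ r) := rfl
  simp only [Nat.succ_sub_one] at this
  omega

theorem rankCount_neg_of_two_le (i : ℕ) (m : ℤ) (n : ℕ) :
    rankCount (i + 2) (-m) n = rankCount (i + 2) m n := by
  have key : ∀ m, rankCount (i + 2) m n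
      = {L | IsRows n L ∧ (0 < durfeeSide (below L i) ∧ listRank i L = m)}.ncard := by
    intro m
    rw [rankCount, if_neg (by omega)]
    congr 1
    refine card_filter_partition fun p => ?_
    have h2 : successiveDurfee p (i + 2 - 1) = durfeeSide (below (rows p) i) := by
      rw [successiveDurfee, rowsBelow_eq]
      rfl
    rw [h2]
    refine and_congr_right fun _ => ?_
    rw [jRank_eq p i]
  have maps : ∀ m, Set.MapsTo (swap i)
      {L | IsRows n L ∧ (0 < durfeeSide (below L i) ∧ listRank i L = m)}
      {L | IsRows n L ∧ (0 < durfeeSide (below L i) ∧ listRank i L = -m)} := by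
    rintro m L ⟨h1, h2, rfl⟩
    obtain ⟨k1, k2, k3, -⟩ := swap_spec h1 h2
    exact ⟨k1, k2, k3⟩
  have inv : ∀ m, Set.LeftInvOn (swap i) (swap i)
      {L | IsRows n L ∧ (0 < durfeeSide (below L i) ∧ listRank i L = m)} :=
    fun m L hL => (swap_spec hL.1 hL.2.1).2.2.2
  have maps' := maps (-m)
  rw [neg_neg] at maps'
  rw [key, key, (Set.InvOn.bijOn ⟨inv m, inv (-m)⟩ (maps m) maps').ncard_eq]

/-! ### Symmetry of the crank via marked ones -/

/-- The crank in terms of the row lengths. The second argument is meant to be the number of ones;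
a smaller value gives the statistic for a graph with only `w` of its ones taken into account. -/
def crankStat (L : List ℕ) (w : ℕ) : ℤ :=
  if w = 0 then (L.headD 0 : ℤ) else (L.countP (fun x => w < x) : ℤ) - w

theorem crank_eq {n : ℕ} (p : n.Partition) :
    crank p = crankStat (rows p) ((rows p).count 1) := by
  rw [crank, crankStat, sup_parts, ← coe_rows]
  simp [List.countP_eq_length_filter]

/-- The Ferrers graphs with `n` cells, with `w` marked rows of length one, that have `w + m` rows
longer than `w`. -/
def markedRows (m : ℤ) (n : ℕ) : Set (List ℕ × ℕ) :=
  {P | IsRows n P.1 ∧ P.2 ≤ P.1.count 1 ∧ (P.1.countP (fun x => P.2 < x) : ℤ) - P.2 = m}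

/-- The Ferrers graphs with `n` cells, with `w` marked rows of length one, for which the statistic
`crankStat` is `m`. -/
def markedCrank (m : ℤ) (n : ℕ) : Set (List ℕ × ℕ) :=
  {P | IsRows n P.1 ∧ P.2 ≤ P.1.count 1 ∧ crankStat P.1 P.2 = m}

/-- The blocks of rows of a Ferrers graph with `w` marked rows of length one: the rows longer
than `w`, and the other unmarked rows. -/
structure IsMarkedFrame (w : ℕ) (T B : List ℕ) : Prop where
  sorted_left : T.Pairwise (· ≥ ·)
  lt_left : ∀ t ∈ T, w + 1 ≤ t
  sorted_right : B.Pairwise (· ≥ ·)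
  right_pos : ∀ b ∈ B, 0 < b
  right_le : ∀ b ∈ B, b ≤ w

/-- `T.length` becomes the new number of marked ones; the shift by `T.length + 1` makes the new long
rows exceed it. -/
theorem isMarkedFrame_exchange (w : ℕ) (T B : List ℕ) :
    IsMarkedFrame T.length (up (T.length + 1) w B) (down (w + 1) T) where
  sorted_left := pairwise_up _ _ _
  lt_left _ := le_of_mem_up
  sorted_right := pairwise_down _ _
  right_pos _ := pos_of_mem_down
  right_le _ := le_of_mem_down

/-- Exchange the number of rows longer than the number `w` of marked ones with `w`. -/
def markedSwap (P : List ℕ × ℕ) : List ℕ × ℕ :=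
  let r := P.1.countP (fun x => P.2 < x)
  (up (r + 1) P.2 ((P.1.drop r).take (P.1.length - r - P.2)) ++
    (down (P.2 + 1) (P.1.take r) ++ List.replicate r 1), r)

theorem IsMarkedFrame.spec {w : ℕ} {T B : List ℕ} (h : IsMarkedFrame w T B) :
    IsRows (T.sum + B.sum + w) (T ++ (B ++ List.replicate w 1)) ∧
      w ≤ (T ++ (B ++ List.replicate w 1)).count 1 ∧
      (T ++ (B ++ List.replicate w 1)).countP (fun x => w < x) = T.length ∧
      markedSwap (T ++ (B ++ List.replicate w 1), w) =
        (up (T.length + 1) w B ++ (down (w + 1) T ++ List.replicate T.length 1), T.length) := by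
  have hc : (T ++ (B ++ List.replicate w 1)).countP (fun x => w < x) = T.length := by
    have h1 : T.countP (fun x => w < x) = T.length := by
      rw [List.countP_eq_length]
      intro a ha
      simpa using h.lt_left a ha
    have h2 : (B ++ List.replicate w 1).countP (fun x => w < x) = 0 := by
      rw [List.countP_eq_zero]
      intro a ha
      rcases List.mem_append.1 ha with ha | ha
      · simpa using h.right_le a ha
      · have := List.mem_replicate.1 ha
        simp
        omega
    rw [List.countP_append, h1, h2, add_zero]
  refine ⟨⟨?_, ?_, ?_⟩, ?_, hc, ?_⟩
  · rw [List.pairwise_append, List.pairwise_append]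
    refine ⟨h.sorted_left, ⟨h.sorted_right, ?_, ?_⟩, ?_⟩
    · exact List.pairwise_replicate.2 (Or.inr le_rfl)
    · intro a ha b hb
      rw [(List.mem_replicate.1 hb).2]
      exact h.right_pos a ha
    · intro a ha b hb
      have h1 := h.lt_left a ha
      rcases List.mem_append.1 hb with hb | hb
      · have := h.right_le b hb
        omega
      · have := (List.mem_replicate.1 hb).2
        omega
  · intro x hx
    simp only [List.mem_append, List.mem_replicate] at hx
    rcases hx with hx | hx | hx
    · have := h.lt_left x hx
      omega
    · exact h.right_pos x hx
    · omega
  · simp [add_assoc]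
  · simp only [List.count_append, List.count_replicate_self]
    omega
  · have h3 : (T ++ (B ++ List.replicate w 1)).length - T.length - w = B.length := by
      simp only [List.length_append, List.length_replicate]
      omega
    simp only [markedSwap, hc, h3, List.drop_left, List.take_left]

theorem countP_one_lt_add_count {L : List ℕ} (h : ∀ x ∈ L, 0 < x) :
    L.countP (fun x => 1 < x) + L.count 1 = L.length := by
  rw [List.length_eq_countP_add_countP (fun x => decide (1 < x)), List.count_eq_countP]
  congr 1
  refine List.countP_congr fun x hx => ?_
  have := h x hx
  simp
  omega

theorem exists_markedFrame {n w : ℕ} {L : List ℕ} (hL : IsRows n L) (hw : w ≤ L.count 1) :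
    ∃ T B, IsMarkedFrame w T B ∧ L = T ++ (B ++ List.replicate w 1) := by
  set r := L.countP (fun x => w < x) with hr
  have hlt := lt_countP_iff hL.sorted
  have hcount := countP_one_lt_add_count hL.pos
  have hrl : r ≤ L.length := List.countP_le_length
  -- For `w > 0` a row longer than `w` is not a one, so long rows and marked ones are disjoint.
  have hrw : r + w ≤ L.length := by
    rcases Nat.eq_zero_or_pos w with h0 | h0
    · omega
    · have : r ≤ L.countP (fun x => 1 < x) := by
        refine List.countP_mono_left fun x _ hx => ?_
        simp at hx ⊢
        omega
      omega
  -- The rows longer than one come first and number at most `L.length - w`, so the last `w` rows are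
  -- ones.
  have hrep : (L.drop r).drop (L.length - r - w) = List.replicate w 1 := by
    rw [List.drop_drop, show r + (L.length - r - w) = L.length - w by omega,
      List.eq_replicate_iff]
    refine ⟨by rw [List.length_drop]; omega, fun x hx => ?_⟩
    have hx0 := hL.pos x (List.mem_of_mem_drop hx)
    obtain ⟨i, hi, rfl⟩ := List.mem_drop_iff_getElem.1 hx
    have := hlt (L.length - w + i) 1
    rw [List.getD_eq_getElem _ _ (by omega)] at this
    omega
  refine ⟨L.take r, (L.drop r).take (L.length - r - w),
    ⟨hL.sorted.take, fun x hx => ?_, hL.sorted.drop.take, fun x hx => ?_, fun x hx => ?_⟩, ?_⟩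
  · obtain ⟨i, hi, rfl⟩ := List.mem_take_iff_getElem.1 hx
    have := (hlt i w).1 (by omega)
    rwa [List.getD_eq_getElem _ _ (by omega)] at this
  · exact hL.pos x (List.mem_of_mem_drop (List.mem_of_mem_take hx))
  · obtain ⟨i, hi, rfl⟩ := List.mem_drop_iff_getElem.1 (List.mem_of_mem_take hx)
    have := hlt (r + i) w
    rw [List.getD_eq_getElem _ _ (by omega)] at this
    omega
  · rw [← hrep, List.take_append_drop, List.take_append_drop]

/-- With `r` long rows the number of cells is `r * (w + 1) + w` plus the sizes of `B` and of `T`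
beyond column `w + 1`, and `r * (w + 1) + w` is symmetric in `r` and `w`. -/
theorem markedSwap_spec {m : ℤ} {n : ℕ} {P : List ℕ × ℕ} (hP : P ∈ markedRows m n) :
    markedSwap P ∈ markedRows (-m) n ∧ markedSwap (markedSwap P) = P := by
  obtain ⟨L, w⟩ := P
  obtain ⟨hL, hw, hm⟩ := hP
  simp only at hL hw hm
  obtain ⟨T, B, hF, rfl⟩ := exists_markedFrame hL hw
  obtain ⟨h1, h2, h3, h4⟩ := hF.spec
  obtain ⟨k1, k2, k3, k4⟩ := (isMarkedFrame_exchange w T B).spec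
  rw [length_up] at k3 k4
  rw [h4, k4, down_up hF.sorted_right hF.right_pos hF.right_le, up_down hF.sorted_left hF.lt_left]
  refine ⟨⟨?_, k2, ?_⟩, rfl⟩
  · convert k1
    rw [← hL.sum, h1.sum, sum_up hF.right_le, ← sum_down hF.sorted_left hF.lt_left]
    ring
  · simp only [h3] at hm
    simp only [k3]
    omega

theorem ncard_markedRows_neg (m : ℤ) (n : ℕ) :
    (markedRows (-m) n).ncard = (markedRows m n).ncard := by
  have maps : ∀ m, Set.MapsTo markedSwap (markedRows m n) (markedRows (-m) n) :=
    fun m P hP => (markedSwap_spec hP).1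
  have inv : ∀ m, Set.LeftInvOn markedSwap markedSwap (markedRows m n) :=
    fun m P hP => (markedSwap_spec hP).2
  have maps' := maps (-m)
  rw [neg_neg] at maps'
  exact (Set.InvOn.bijOn ⟨inv m, inv (-m)⟩ (maps m) maps').ncard_eq.symm

theorem IsRows.down {n : ℕ} {L : List ℕ} (hL : IsRows n L) :
    IsRows n (down 0 L) ∧ (JRank.down 0 L).length = L.headD 0 ∧
      (JRank.down 0 L).headD 0 = L.length ∧ JRank.down 0 (JRank.down 0 L) = L := by
  have hud : up 0 L.length (JRank.down 0 L) = L := up_down hL.sorted (by simp)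
  have hhead : (JRank.down 0 L).headD 0 = L.length := by
    cases L with
    | nil => simp [JRank.down, conj]
    | cons a L =>
      have ha : 0 < a := hL.pos a (by simp)
      obtain ⟨a, rfl⟩ := Nat.exists_eq_succ_of_ne_zero ha.ne'
      have : L.countP (fun x => 0 < x) = L.length := by
        rw [List.countP_eq_length]
        intro x hx
        simpa using hL.pos x (by simp [hx])
      simp [JRank.down, conj, List.range_succ_eq_map, this]
  refine ⟨⟨pairwise_down _ _, fun _ => pos_of_mem_down, ?_⟩, length_down _ _, hhead, ?_⟩
  · rw [← hL.sum, ← sum_down hL.sorted (c := 0) (by simp), mul_zero, zero_add]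
  · have h2 : ∀ X, (JRank.down 0 X) = conj X (X.headD 0) := by simp [JRank.down]
    rw [h2 (JRank.down 0 L), hhead]
    rw [up] at hud
    simpa using hud

theorem countP_pos_eq_length {n : ℕ} {L : List ℕ} (hL : IsRows n L) :
    L.countP (fun x => 0 < x) = L.length := by
  rw [List.countP_eq_length]
  simpa using hL.pos

/-- The two statistics differ only for `w = 0`, where they are the largest part and the number of
parts; conjugating just those graphs matches them. -/
theorem ncard_markedCrank (m : ℤ) (n : ℕ) : (markedCrank m n).ncard = (markedRows m n).ncard := by
  let f : List ℕ × ℕ → List ℕ × ℕ := fun P => if P.2 = 0 then (down 0 P.1, 0) else P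
  have inv : ∀ P : List ℕ × ℕ, IsRows n P.1 → f (f P) = P := by
    rintro ⟨L, w⟩ hL
    by_cases hw : w = 0
    · simp [f, hw, hL.down.2.2.2]
    · simp [f, hw]
  refine (Set.InvOn.bijOn (f := f) (f' := f) ⟨fun P hP => inv P hP.1, fun P hP => inv P hP.1⟩
    ?_ ?_).ncard_eq
  · rintro ⟨L, w⟩ ⟨h1, h2, h3⟩
    by_cases hw : w = 0
    · simp only [f, hw, if_true, crankStat] at h3 ⊢
      refine ⟨h1.down.1, Nat.zero_le _, ?_⟩
      simp only [countP_pos_eq_length h1.down.1, h1.down.2.1]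
      simpa using h3
    · simp only [f, hw, if_false, crankStat] at h3 ⊢
      exact ⟨h1, h2, h3⟩
  · rintro ⟨L, w⟩ ⟨h1, h2, h3⟩
    by_cases hw : w = 0
    · simp only [f, hw, if_true, countP_pos_eq_length h1] at h3 ⊢
      refine ⟨h1.down.1, Nat.zero_le _, ?_⟩
      simp only [crankStat, if_true, h1.down.2.2.1]
      simpa using h3
    · simp only [f, hw, if_false] at h3 ⊢
      exact ⟨h1, h2, by simpa only [crankStat, hw, if_false] using h3⟩

theorem finite_markedCrank (m : ℤ) (n : ℕ) : (markedCrank m n).Finite := by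
  refine ((finite_isRows n).prod (Set.finite_Iic n)).subset ?_
  rintro ⟨L, w⟩ ⟨h1, h2, -⟩
  refine ⟨h1, ?_⟩
  rw [Set.mem_Iic, ← h1.sum]
  exact h2.trans (List.count_le_length.trans (List.length_le_sum_of_one_le L h1.pos))

/-- Split by whether some one is unmarked and delete such a one. This is the factor $1-q$ in the
crank generating function. -/
theorem ncard_markedCrank_succ (m : ℤ) {n : ℕ} (hn : n ≠ 0) :
    (markedCrank m (n + 1)).ncard = (markedCrank m n).ncard +
      {L | IsRows (n + 1) L ∧ crankStat L (L.count 1) = m}.ncard := by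
  have hfin : {L | IsRows (n + 1) L ∧ crankStat L (L.count 1) = m}.Finite :=
    (finite_isRows _).subset fun L hL => hL.1
  have hinj1 : Function.Injective (fun P : List ℕ × ℕ => (P.1 ++ [1], P.2)) := by
    rintro ⟨L, w⟩ ⟨L', w'⟩ h
    simpa using h
  have hinj2 : Function.Injective (fun L : List ℕ => (L, L.count 1)) :=
    fun L L' h => (Prod.ext_iff.1 h).1
  -- An extra one is never longer than `w ≥ 1`, and for `w = 0` it changes the largest part only of
  -- the empty graph. This is why `n ≠ 0` is needed.
  have hstat : ∀ L : List ℕ, L ≠ [] → ∀ w, crankStat (L ++ [1]) w = crankStat L w := by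
    intro L hL w
    rw [crankStat, crankStat]
    split_ifs with h
    · cases L <;> simp_all
    · have : ¬ w < 1 := by omega
      simp [List.countP_append, this]
  have hne : ∀ L, IsRows n L → L ≠ [] := by
    rintro L hL rfl
    exact hn (by simpa using hL.sum.symm)
  rw [← Set.ncard_image_of_injective (markedCrank m n) hinj1, ← Set.ncard_image_of_injective _ hinj2,
    ← Set.ncard_union_eq ?_ ((finite_markedCrank m n).image _) (hfin.image _)]
  · congr 1
    ext ⟨L, w⟩
    constructor
    · rintro ⟨h1, h2, h3⟩
      simp only at h1 h2 h3
      rcases lt_or_eq_of_le h2 with h2 | rfl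
      · left
        have h1L : 1 ∈ L := List.count_pos_iff.1 (by omega)
        have hL0 : L ≠ [] := List.ne_nil_of_mem h1L
        have hsplit := List.dropLast_append_getLast hL0
        have hs := h1.sorted
        rw [← hsplit, List.pairwise_append] at hs
        have hlast : L.getLast hL0 = 1 := by
          refine le_antisymm ?_ (h1.pos _ (List.getLast_mem hL0))
          rw [← hsplit] at h1L
          rcases List.mem_append.1 h1L with h | h
          · exact hs.2.2 _ h _ (by simp)
          · simp at h
            omega
        rw [hlast] at hsplit
        have hrows : IsRows n L.dropLast := by
          refine ⟨hs.1, fun x hx => h1.pos x (List.mem_of_mem_dropLast hx), ?_⟩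
          have := h1.sum
          rw [← hsplit, List.sum_append, List.sum_singleton] at this
          omega
        refine ⟨(L.dropLast, w), ⟨hrows, ?_, ?_⟩, by simp [hsplit]⟩
        · rw [← hsplit, List.count_append] at h2
          simp at h2 ⊢
          omega
        · rw [← hsplit, hstat _ (hne _ hrows)] at h3
          exact h3
      · right
        exact ⟨L, ⟨h1, h3⟩, rfl⟩
    · rintro (⟨⟨L', w'⟩, ⟨h1, h2, h3⟩, h⟩ | ⟨L', ⟨h1, h2⟩, h⟩)
      · simp only [Prod.mk.injEq] at h h2 h1 h3
        obtain ⟨rfl, rfl⟩ := h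
        refine ⟨⟨?_, ?_, ?_⟩, ?_, ?_⟩
        · rw [List.pairwise_append]
          refine ⟨h1.sorted, List.pairwise_singleton _ _, fun a ha b hb => ?_⟩
          rw [List.mem_singleton.1 hb]
          exact h1.pos a ha
        · intro x hx
          rcases List.mem_append.1 hx with hx | hx
          · exact h1.pos x hx
          · simp at hx
            omega
        · simp [h1.sum]
        · simp only [List.count_append]
          omega
        · rw [hstat _ (hne _ h1)]
          exact h3
      · simp only [Prod.mk.injEq] at h
        obtain ⟨rfl, rfl⟩ := h
        exact ⟨h1, le_rfl, h2⟩
  · rw [Set.disjoint_left]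
    rintro _ ⟨⟨L, w⟩, ⟨-, h2, -⟩, rfl⟩ ⟨L', -, h⟩
    simp only [Prod.mk.injEq] at h h2
    obtain ⟨rfl, h⟩ := h
    rw [List.count_append] at h
    simp at h
    omega

theorem crankCount_neg (m : ℤ) (n : ℕ) : crankCount (-m) n = crankCount m n := by
  by_cases h1 : n = 1
  · simp only [crankCount, h1, if_true]
    split_ifs <;> first | rfl | omega
  have key : ∀ m, crankCount m n
      = {L | IsRows n L ∧ crankStat L (L.count 1) = m}.ncard := by
    intro m
    rw [crankCount, if_neg h1]
    congr 1
    exact card_filter_partition fun p => by rw [crank_eq]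
  rw [key, key]
  rcases n with _ | n
  · congr 2
    ext L
    refine and_congr_right fun hL => ?_
    have : L = [] := by
      cases L with
      | nil => rfl
      | cons a L =>
        have := hL.pos a (by simp)
        have := hL.sum
        simp at this
        omega
    subst this
    simp [crankStat]
    omega
  · have hn : n ≠ 0 := by omega
    have e1 := ncard_markedCrank_succ m hn
    have e2 := ncard_markedCrank_succ (-m) hn
    rw [ncard_markedCrank, ncard_markedCrank] at e1 e2
    rw [ncard_markedRows_neg, ncard_markedRows_neg] at e2
    omega

theorem rankCount_neg {j : ℕ} (hj : 1 ≤ j) (m : ℤ) (n : ℕ) :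
    rankCount j (-m) n = rankCount j m n := by
  obtain rfl | h := eq_or_lt_of_le hj
  · simpa only [rankCount, if_true] using crankCount_neg m n
  · obtain ⟨i, rfl⟩ := Nat.exists_eq_add_of_le' h
    exact rankCount_neg_of_two_le i m n

/-! ### Odd and even parts of the binomials, and the moments -/

/-- The odd polynomial function `x ∏_{i=1}^k (x² - i²)`. -/
def oddProd (k : ℕ) (x : ℤ) : ℤ := x * ∏ i ∈ Finset.range k, (x ^ 2 - ((i : ℤ) + 1) ^ 2)

theorem oddProd_neg (k : ℕ) (x : ℤ) : oddProd k (-x) = -oddProd k x := by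
  simp [oddProd]

theorem oddProd_eq (k : ℕ) (x : ℤ) :
    oddProd k x = ∏ i ∈ Finset.range (2 * k + 1), (x + k - i) := by
  induction k with
  | zero => simp [oddProd]
  | succ k ih =>
    -- Splitting off both end factors `x - (k + 1)` and `x + (k + 1)` produces the new factor `x ^ 2
    -- - (k + 1) ^ 2`.
    rw [show 2 * (k + 1) + 1 = (2 * k + 1) + 1 + 1 by ring, Finset.prod_range_succ,
      Finset.prod_range_succ']
    have h : ∏ i ∈ Finset.range (2 * k + 1), (x + ((k + 1 : ℕ) : ℤ) - ((i + 1 : ℕ) : ℤ))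
        = ∏ i ∈ Finset.range (2 * k + 1), (x + k - i) :=
      Finset.prod_congr rfl fun i _ => by push_cast; ring
    rw [h, ← ih, oddProd, oddProd, Finset.prod_range_succ]
    push_cast
    ring

theorem eval_g_succ (k : ℕ) (x : ℤ) : (g (k + 1)).eval x = x * oddProd k x := by
  rw [eval_g, Finset.prod_range_succ', oddProd]
  push_cast
  ring

/-- The consecutive factors run from `x + k` down to `x - k - 1`. All but the last are symmetric
about `x` and give `oddProd k x`; expanding the last one, `x - (k + 1)`, separates the even part
from the odd part. -/
theorem factorial_mul_choose (k : ℕ) (x : ℤ) :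
    ((2 * (k + 1)).factorial : ℤ) * Ring.choose (x + k) (2 * (k + 1))
      = (g (k + 1)).eval x - (k + 1) * oddProd k x := by
  have h := Ring.descPochhammer_eq_factorial_smul_choose (x + k) (2 * (k + 1))
  rw [nsmul_eq_mul, ← Polynomial.aeval_eq_smeval, Polynomial.coe_aeval_eq_eval,
    descPochhammer_eval_eq_prod_range] at h
  rw [← h, eval_g_succ, show 2 * (k + 1) = 2 * k + 1 + 1 by ring, Finset.prod_range_succ,
    ← oddProd_eq]
  push_cast
  ring

theorem finsum_rankCount (f : ℤ → ℤ) (j n : ℕ) :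
    ∑ᶠ m : ℤ, f m * rankCount j m n
      = ∑ m ∈ Finset.Icc (-(n : ℤ)) n, f m * rankCount j m n := by
  refine finsum_eq_sum_of_support_subset _ fun m hm => ?_
  rw [Finset.coe_Icc, Set.mem_Icc, ← abs_le]
  by_contra h
  exact hm (by simp only [rankCount_eq_zero j m n (not_le.1 h), mul_zero])

/-- By the symmetry, the substitution `m ↦ -m` turns the sum into its own negative. -/
theorem sum_odd_mul_rankCount {f : ℤ → ℤ} (hf : ∀ m, f (-m) = -f m) {j : ℕ} (hj : 1 ≤ j) (n : ℕ) :
    ∑ m ∈ Finset.Icc (-(n : ℤ)) n, f m * rankCount j m n = 0 := by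
  have h : ∑ m ∈ Finset.Icc (-(n : ℤ)) n, f m * rankCount j m n
      = ∑ m ∈ Finset.Icc (-(n : ℤ)) n, f (-m) * rankCount j (-m) n := by
    refine Finset.sum_nbij' (fun m => -m) (fun m => -m) ?_ ?_ ?_ ?_ ?_ <;> intro m hm
    · simp only [Finset.mem_Icc] at hm ⊢
      omega
    · simp only [Finset.mem_Icc] at hm ⊢
      omega
    · simp
    · simp
    · simp
  simp only [hf, rankCount_neg hj, neg_mul, Finset.sum_neg_distrib] at h
  omega

theorem factorial_mul_symMoment {j k : ℕ} (hj : 1 ≤ j) (hk : 1 ≤ k) (n : ℕ) :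
    ((2 * k).factorial : ℤ) * symMoment j (2 * k) n
      = ∑ m ∈ Finset.Icc (-(n : ℤ)) n, (g k).eval m * rankCount j m n := by
  obtain ⟨k, rfl⟩ := Nat.exists_eq_add_of_le' hk
  have h : (((2 * (k + 1) : ℕ) : ℤ) - 1) / 2 = k := by
    omega
  rw [symMoment, h, finsum_rankCount (fun m => Ring.choose (m + (k : ℤ)) (2 * (k + 1))),
    Finset.mul_sum]
  simp only [← mul_assoc, factorial_mul_choose, sub_mul, Finset.sum_sub_distrib]
  rw [sum_odd_mul_rankCount (f := fun m => ((k : ℤ) + 1) * oddProd k m)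
    (fun m => by rw [oddProd_neg, mul_neg]) hj, sub_zero]

end JRank

theorem theorem6p1 (j k n : ℕ) (hj : 1 ≤ j) (hk : 1 ≤ k) :
    (JRank.symMoment j (2 * k) n : ℚ)
        = 1 / ((2 * k).factorial : ℚ)
          * ∑ m ∈ Finset.Icc (-(n : ℤ)) (n : ℤ),
              (((JRank.g k).eval m : ℤ) : ℚ) * (JRank.rankCount j m n : ℚ)
    ∧ JRank.moment j (2 * k) n
        = ∑ t ∈ Finset.Icc 1 k,
            ((2 * t).factorial : ℤ) * JRank.sStar k t * JRank.symMoment j (2 * t) n := by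
  constructor
  · have h := congrArg (Int.cast (R := ℚ)) (JRank.factorial_mul_symMoment hj hk n)
    push_cast at h
    have h0 : ((2 * k).factorial : ℚ) ≠ 0 := by exact_mod_cast (2 * k).factorial_ne_zero
    rw [← h, one_div, inv_mul_cancel_left₀ h0]
  · rw [JRank.moment, JRank.finsum_rankCount fun m => m ^ (2 * k)]
    have h1 : ∀ t ∈ Finset.Icc 1 k,
        ((2 * t).factorial : ℤ) * JRank.sStar k t * JRank.symMoment j (2 * t) n
          = ∑ m ∈ Finset.Icc (-(n : ℤ)) n,
              JRank.sStar k t * (JRank.g t).eval m * JRank.rankCount j m n := by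
      intro t ht
      rw [mul_right_comm, JRank.factorial_mul_symMoment hj (Finset.mem_Icc.1 ht).1, mul_comm,
        Finset.mul_sum]
      simp only [mul_assoc]
    rw [Finset.sum_congr rfl h1, Finset.sum_comm]
    refine Finset.sum_congr rfl fun m _ => ?_
    rw [← Finset.sum_mul]
    congr 1
    have h2 := congrArg (Polynomial.eval m) (JRank.sStar_spec k hk)
    simpa [Polynomial.eval_finsetSum] using h2
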